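/- Let $E$ be a real Banach lattice whose norm is order continuous, i.e. $\inf_{x\in S}\|x\|=0$ for every nonempty downward directed set $S\subset E$ with $\inf S=0$ (equivalently, $\|x_\alpha\|\to 0$ for every net $x_\alpha\downarrow 0$). Write $x\perp y$ if $|x|\wedge|y|=0$. A band in $E$ is a linear subspace $Y$ such that $|x|\le|y|$ with $y\in Y$ implies $x\in Y$, and such that the supremum of any family of elements of $Y$ belongs to $Y$ whenever it exists in $E$. A linear operator $R:E\to E$ is called band-preserving if $R(Y)\subset Y$ for every band $Y\subset E$. For a real number $\varepsilon\ge 0$, a linear operator $T:E\to E$ is called $\varepsilon$-band preserving if $$\sup\{\,\|\,|Tx|\wedge y\,\| : y\ge 0,\ y\perp x\,\}\le \varepsilon\|x\|\qquad\text{for every } x\in E.$$ If $\varepsilon\ge 0$ and $T\in B(E)$ is $\varepsilon$-band preserving, then there exists a band-preserving operator $R\in B(E)$ such that $\|R\|\le\|T\|$ and $\|T-R\|\le 4\varepsilon$. -/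

import Mathlib

namespace BanachLattice

variable {E : Type*} [NormedAddCommGroup E] [NormedSpace ℝ E] [Lattice E]

/-- Two elements `x`, `y` of a vector lattice are disjoint, `x ⊥ y`, if `|x| ∧ |y| = 0`. -/
def Disj (x y : E) : Prop := |x| ⊓ |y| = 0

/-- A band: a linear subspace `Y` that is solid (an order ideal) and that contains the supremum of
every family of its elements whose supremum exists in the whole lattice. -/
structure IsBand (Y : Submodule ℝ E) : Prop where
  solid : ∀ ⦃x y : E⦄, y ∈ Y → |x| ≤ |y| → x ∈ Y
  isLUB_mem : ∀ ⦃S : Set E⦄ ⦃a : E⦄, (∀ y ∈ S, y ∈ Y) → IsLUB S a → a ∈ Y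

/-- A linear operator is band-preserving if it maps every band into itself. -/
def BandPreserving (T : E →ₗ[ℝ] E) : Prop :=
  ∀ Y : Submodule ℝ E, IsBand Y → ∀ x ∈ Y, T x ∈ Y

/-- A linear operator is `ε`-band preserving if
`sup {‖|T x| ∧ y‖ : y ≥ 0, y ⊥ x} ≤ ε ‖x‖` for every `x`, the inequality for the supremum being
expressed as an inequality for every member of the set. -/
def AlmostBandPreserving (ε : ℝ) (T : E →ₗ[ℝ] E) : Prop :=
  ∀ x y : E, 0 ≤ y → Disj y x → ‖|T x| ⊓ y‖ ≤ ε * ‖x‖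

/-- The norm is order continuous: if `S` is a (nonempty) downward directed set with infimum `0`
(`S ↓ 0`), then the norms of its elements have infimum `0`. Since the norm of a Banach lattice is
monotone on positive elements, this says that `‖x α‖ → 0` for every net `x α ↓ 0`. -/
def OrderContinuousNorm (E : Type*) [NormedAddCommGroup E] [Lattice E] : Prop :=
  ∀ S : Set E, S.Nonempty → DirectedOn (fun a b => b ≤ a) S → IsGLB S 0 →
    IsGLB ((fun x => ‖x‖) '' S) 0

end BanachLattice

set_option maxSynthPendingDepth 3

namespace BanachLattice

/-! ### Order continuity: monotone limits in norm -/

section Order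

variable {E : Type*} [NormedAddCommGroup E] [Lattice E] [IsOrderedAddMonoid E] [HasSolidNorm E]

/-! Conjugating `T` by a reflection `P - (1 - P)`, with `P` a band projection, flips the sign of the
two off-diagonal blocks of `T`. These blocks have norm at most `ε`, so each conjugate, and each
convex combination of conjugates, stays within `4 * ε` of `T` and has norm at most `‖T‖`. Averaging
over finitely many reflections gives an operator commuting with the corresponding projections
(`exists_mem_convexHull_commute`).

An ultrafilter limit along finite sets of projections is taken weakly, so it only yields a map `B :
E → E**`, but one that is local: projections pass from one argument to the other
(`exists_isLocal_limit`). The crux is that a local `B` takes values in `E`. A local form has a Hahn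
decomposition by a band projection (`IsLocal.exists_hahn`). Applied to the forms `t • J - B`, where
`J` embeds `E` in `E**`, it plays the role of spectral projections: `B x` is a norm limit of step
elements `∑ tᵢ • Pᵢ x` of `E`, hence lies in the closed subspace `J E`. The resulting operator
commutes with all band projections, and by order continuity every band is the range of one. -/

theorem norm_le_norm_of_nonneg_of_le {x y : E} (hx : 0 ≤ x) (hxy : x ≤ y) : ‖x‖ ≤ ‖y‖ :=
  HasSolidNorm.solid (by rwa [abs_of_nonneg hx, abs_of_nonneg (hx.trans hxy)])

/-- In a Banach lattice with order continuous norm every nonempty upward directed set that is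
bounded above has a supremum, and the supremum is a norm limit. -/
theorem exists_isLUB_mem_closure [CompleteSpace E] [NormedSpace ℝ E]
    (hE : OrderContinuousNorm E) {S : Set E}
    (hS : S.Nonempty) (hdir : DirectedOn (· ≤ ·) S) (hb : BddAbove S) :
    ∃ a, IsLUB S a ∧ a ∈ closure S := by
  obtain ⟨s₀, hs₀⟩ := hS
  obtain ⟨u₀, hu₀⟩ := hb
  set W : Set E := {w | ∃ u ∈ upperBounds S, ∃ s ∈ S, w = u - s} with hW
  have hWdir : DirectedOn (fun a b => b ≤ a) W := by
    rintro _ ⟨u, hu, s, hs, rfl⟩ _ ⟨u', hu', s', hs', rfl⟩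
    obtain ⟨t, ht, hst, hst'⟩ := hdir s hs s' hs'
    exact ⟨u ⊓ u' - t, ⟨_, fun z hz => le_inf (hu hz) (hu' hz), t, ht, rfl⟩,
      sub_le_sub inf_le_left hst, sub_le_sub inf_le_right hst'⟩
  have hGLB : IsGLB W 0 := by
    constructor
    · rintro _ ⟨u, hu, s, hs, rfl⟩
      exact sub_nonneg.2 (hu hs)
    · intro b hb
      -- A positive lower bound of `W` can be subtracted from any upper bound of `S`, hence
      -- arbitrarily often; the Archimedean property forces it to vanish.
      have hc : ∀ u ∈ upperBounds S, u - (b ⊔ 0) ∈ upperBounds S := by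
        intro u hu s hs
        have h1 : b ⊔ 0 ≤ u - s := sup_le (hb ⟨u, hu, s, hs, rfl⟩) (sub_nonneg.2 (hu hs))
        exact le_sub_comm.1 h1
      have hn : ∀ n : ℕ, u₀ - n • (b ⊔ 0) ∈ upperBounds S := by
        intro n
        induction n with
        | zero => simpa using hu₀
        | succ k ih =>
          have := hc _ ih
          rwa [sub_sub, ← succ_nsmul] at this
      have hnorm : ∀ n : ℕ, n * ‖b ⊔ 0‖ ≤ ‖u₀ - s₀‖ := by
        intro n
        have h1 : n • (b ⊔ 0) ≤ u₀ - s₀ := le_sub_comm.1 (hn n hs₀)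
        have h2 := norm_le_norm_of_nonneg_of_le (nsmul_nonneg le_sup_right n) h1
        rwa [← Nat.cast_smul_eq_nsmul ℝ, norm_smul, Real.norm_natCast] at h2
      have h0 : ‖b ⊔ 0‖ = 0 := by
        by_contra hne
        have hpos : 0 < ‖b ⊔ 0‖ := lt_of_le_of_ne (norm_nonneg _) (Ne.symm hne)
        obtain ⟨n, hn⟩ := exists_nat_gt (‖u₀ - s₀‖ / ‖b ⊔ 0‖)
        rw [div_lt_iff₀ hpos] at hn
        exact absurd (hnorm n) (not_le.2 hn)
      rw [norm_eq_zero] at h0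
      exact h0 ▸ le_sup_left
  have hinf := hE W ⟨u₀ - s₀, u₀, hu₀, s₀, hs₀, rfl⟩ hWdir hGLB
  have key : ∀ n : ℕ, ∃ u ∈ upperBounds S, ∃ s ∈ S, ‖u - s‖ < 1 / ((n : ℝ) + 1) := by
    intro n
    by_contra! hcon
    have : (1 / ((n : ℝ) + 1)) ∈ lowerBounds ((fun x => ‖x‖) '' W) := by
      rintro _ ⟨_, ⟨u, hu, s, hs, rfl⟩, rfl⟩
      exact hcon u hu s hs
    exact absurd (hinf.2 this) (not_le.2 Nat.one_div_pos_of_nat)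
  choose u hu s hs hus using key
  have hsub : ∀ n, ∀ t ∈ S, s n ≤ t → ‖t - s n‖ < 1 / ((n : ℝ) + 1) := fun n t ht hst =>
    (norm_le_norm_of_nonneg_of_le (sub_nonneg.2 hst) (sub_le_sub_right (hu n ht) _)).trans_lt (hus n)
  have hcauchy : CauchySeq s := by
    rw [Metric.cauchySeq_iff']
    intro ε hε
    obtain ⟨N, hN⟩ := exists_nat_one_div_lt (half_pos hε)
    refine ⟨N, fun n hn => ?_⟩
    obtain ⟨t, ht, h1, h2⟩ := hdir _ (hs n) _ (hs N)
    have e1 := hsub n t ht h1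
    have e2 := hsub N t ht h2
    have e3 : 1 / ((n : ℝ) + 1) ≤ 1 / ((N : ℝ) + 1) := Nat.one_div_le_one_div hn
    rw [dist_eq_norm]
    calc ‖s n - s N‖ = ‖(t - s N) - (t - s n)‖ := by congr 1; abel
      _ ≤ ‖t - s N‖ + ‖t - s n‖ := norm_sub_le _ _
      _ < ε := by linarith
  obtain ⟨a, ha⟩ := cauchySeq_tendsto_of_complete hcauchy
  have hua : Filter.Tendsto u Filter.atTop (nhds a) := by
    have h0 : Filter.Tendsto (fun n => u n - s n) Filter.atTop (nhds 0) :=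
      squeeze_zero_norm (fun n => (hus n).le) tendsto_one_div_add_atTop_nhds_zero_nat
    simpa using h0.add ha
  refine ⟨a, ⟨fun t ht => ge_of_tendsto' hua fun n => hu n ht, fun v hv =>
    le_of_tendsto' ha fun n => hv (hs n)⟩, mem_closure_of_tendsto ha (.of_forall hs)⟩

theorem exists_isGLB_mem_closure [CompleteSpace E] [NormedSpace ℝ E]
    (hE : OrderContinuousNorm E) {S : Set E}
    (hS : S.Nonempty) (hdir : DirectedOn (fun a b => b ≤ a) S) (hb : BddBelow S) :
    ∃ a, IsGLB S a ∧ a ∈ closure S := by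
  obtain ⟨a, ha, hac⟩ := exists_isLUB_mem_closure hE (S := -S) hS.neg
    (fun x hx y hy => by
      obtain ⟨z, hz, h1, h2⟩ := hdir _ hx _ hy
      exact ⟨-z, by simpa using hz, le_neg.1 h1, le_neg.1 h2⟩) hb.neg
  refine ⟨-a, ?_, ?_⟩
  · exact isLUB_neg.1 ha
  · have := Set.mem_neg.1 (neg_closure S ▸ hac : a ∈ -closure S)
    exact this

end Order

/-! ### Strict positivity of a functional on order intervals -/

section Functional

variable {E : Type*} [NormedAddCommGroup E] [NormedSpace ℝ E] [CompleteSpace E]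
  [Lattice E] [IsOrderedAddMonoid E] [HasSolidNorm E]

/-- Below an element at which a functional is positive there is an element such that the functional
is strictly positive on the order interval it spans. -/
theorem exists_strictly_pos_below (hE : OrderContinuousNorm E) (f : E →L[ℝ] ℝ) {x : E}
    (hx : 0 ≤ x) :
    ∃ y, 0 ≤ y ∧ y ≤ x ∧ f x ≤ f y ∧ ∀ w, 0 ≤ w → w ≤ y → w ≠ 0 → 0 < f w := by
  let A := {y : E // 0 ≤ y ∧ y ≤ x ∧ f x ≤ f y}
  -- Zorn's lemma: shrink `y` without decreasing `f y`. Chains have bounds because their infima are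
  -- norm limits; at a maximal `y`, removing a nonzero `w` with `f w ≤ 0` would be a further step.
  let r : A → A → Prop := fun y z => z.1 ≤ y.1 ∧ f y.1 ≤ f z.1
  have : Nonempty A := ⟨⟨x, hx, le_rfl, le_rfl⟩⟩
  obtain ⟨⟨y, hy0, hyx, hfy⟩, hmax⟩ : ∃ m : A, ∀ a, r m a → r a m := by
    refine exists_maximal_of_nonempty_chains_bounded (fun c hc hne => ?_)
      (fun h1 h2 => ⟨h2.1.trans h1.1, h1.2.trans h2.2⟩)
    obtain ⟨a, ha, hac⟩ := exists_isGLB_mem_closure hE (S := Subtype.val '' c) (hne.image _)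
      (by
        rintro _ ⟨p, hp, rfl⟩ _ ⟨q, hq, rfl⟩
        rcases eq_or_ne p q with rfl | hpq
        · exact ⟨p, ⟨p, hp, rfl⟩, le_rfl, le_rfl⟩
        rcases hc hp hq hpq with h | h
        · exact ⟨q, ⟨q, hq, rfl⟩, h.1, le_rfl⟩
        · exact ⟨p, ⟨p, hp, rfl⟩, le_rfl, h.1⟩)
      ⟨0, by rintro _ ⟨p, -, rfl⟩; exact p.2.1⟩
    have hfa : ∀ p ∈ c, f p.1 ≤ f a := by
      intro p hp
      refine le_of_forall_pos_le_add fun δ hδ => ?_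
      obtain ⟨δ', hδ', hfδ⟩ := Metric.continuousAt_iff.1 f.continuous.continuousAt δ hδ
      obtain ⟨_, ⟨q, hq, rfl⟩, hqd⟩ := Metric.mem_closure_iff.1 hac δ' hδ'
      have close : ∀ z : E, ‖z - a‖ < δ' → f z ≤ f a + δ := fun z hz => by
        have := hfδ (x := z) (by rwa [dist_eq_norm])
        rw [Real.dist_eq] at this
        linarith [(abs_lt.1 this).2]
      rw [dist_comm, dist_eq_norm] at hqd
      have hpa : a ≤ p.1 := ha.1 ⟨p, hp, rfl⟩
      rcases eq_or_ne p q with rfl | hpq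
      · exact close _ hqd
      rcases hc hp hq hpq with h | h
      · exact h.2.trans (close _ hqd)
      · exact close _ ((norm_le_norm_of_nonneg_of_le (sub_nonneg.2 hpa)
          (sub_le_sub_right h.1 a)).trans_lt hqd)
    obtain ⟨p, hp⟩ := hne
    have hpa : a ≤ p.1 := ha.1 ⟨p, hp, rfl⟩
    refine ⟨⟨a, ha.2 (by rintro _ ⟨p, -, rfl⟩; exact p.2.1), hpa.trans p.2.2.1,
      p.2.2.2.trans (hfa p hp)⟩, fun q hq => ⟨ha.1 ⟨q, hq, rfl⟩, hfa q hq⟩⟩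
  refine ⟨y, hy0, hyx, hfy, fun w hw0 hwy hne => ?_⟩
  by_contra! hfw
  have hfy' : f y ≤ f (y - w) := by rw [map_sub]; linarith
  have := (hmax ⟨y - w, sub_nonneg.2 hwy, (sub_le_self _ hw0).trans hyx, hfy.trans hfy'⟩
    ⟨sub_le_self _ hw0, hfy'⟩).1
  exact hne (le_antisymm (by simpa using this) hw0)

end Functional


/-! ### Band projections -/

section Projection

variable {E : Type*} [NormedAddCommGroup E] [NormedSpace ℝ E] [Lattice E]

/-- Band projections, described as the idempotent operators between `0` and the identity. -/
structure IsBandProj (P : E →L[ℝ] E) : Prop where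
  idem : ∀ x, P (P x) = P x
  nonneg : ∀ ⦃x⦄, 0 ≤ x → 0 ≤ P x
  le_self : ∀ ⦃x⦄, 0 ≤ x → P x ≤ x

theorem isBandProj_one : IsBandProj (1 : E →L[ℝ] E) :=
  ⟨fun _ => rfl, fun _ h => h, fun _ _ => le_rfl⟩

variable [IsOrderedAddMonoid E]

theorem abs_sub_le_abs_add_abs {E : Type*} [AddCommGroup E] [Lattice E] [IsOrderedAddMonoid E]
    (x y : E) : |x - y| ≤ |x| + |y| := by
  simpa [sub_eq_add_neg] using abs_add_le x (-y)

theorem abs_le_of_nonneg_hom {P : E →L[ℝ] E} (h : ∀ ⦃x⦄, 0 ≤ x → 0 ≤ P x) (x : E) :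
    |P x| ≤ P |x| := by
  refine abs_le'.2 ⟨?_, ?_⟩
  · rw [← sub_nonneg, ← map_sub]
    exact h (sub_nonneg.2 (le_abs_self x))
  · rw [← sub_nonneg, ← map_neg, ← map_sub]
    exact h (sub_nonneg.2 (neg_le_abs x))

namespace IsBandProj

variable {P Q : E →L[ℝ] E}

theorem compl (hP : IsBandProj P) : IsBandProj (1 - P) where
  idem x := by simp [hP.idem]
  nonneg x hx := by simpa using hP.le_self hx
  le_self x hx := by simpa using hP.nonneg hx

theorem mono (hP : IsBandProj P) {x y : E} (h : x ≤ y) : P x ≤ P y := by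
  rw [← sub_nonneg, ← map_sub]
  exact hP.nonneg (sub_nonneg.2 h)

theorem ext_nonneg {S T : E →L[ℝ] E} (h : ∀ ⦃x⦄, 0 ≤ x → S x = T x) : S = T := by
  ext x
  rw [← posPart_sub_negPart x, map_sub, map_sub, h (posPart_nonneg x), h (negPart_nonneg x)]

/-- For `x ≥ 0`, `P (Q x)` lies between `0` and `Q x`, so `1 - Q` kills it. -/
theorem mul_mul_self (hP : IsBandProj P) (hQ : IsBandProj Q) : Q * P * Q = P * Q := by
  refine ext_nonneg fun x hx => ?_
  have h1 : (1 - Q) (P (Q x)) ≤ 0 := by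
    simpa [hQ.idem] using hQ.compl.mono (hP.le_self (hQ.nonneg hx))
  have h2 := hQ.compl.nonneg (hP.nonneg (hQ.nonneg hx))
  have h3 := le_antisymm h1 h2
  rw [sub_apply, sub_eq_zero] at h3
  exact h3.symm

theorem commute (hP : IsBandProj P) (hQ : IsBandProj Q) : Commute P Q := by
  have h1 := hP.mul_mul_self hQ
  have h2 := hP.mul_mul_self hQ.compl
  have hQQ : Q * Q = Q := by ext x; exact hQ.idem x
  have h3 : Q * (P * (1 - Q)) = Q * ((1 - Q) * P * (1 - Q)) := by rw [h2]
  have h4 : Q * (P * (1 - Q)) = 0 := by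
    rw [h3]
    simp only [← mul_assoc, mul_sub, mul_one, hQQ, sub_self, zero_mul]
  rw [mul_sub, mul_sub, mul_one, sub_eq_zero, ← mul_assoc, h1] at h4
  exact h4.symm

theorem comm_apply (hP : IsBandProj P) (hQ : IsBandProj Q) (x : E) : P (Q x) = Q (P x) :=
  DFunLike.congr_fun (hP.commute hQ).eq x

theorem disj (hP : IsBandProj P) {x y : E} (hx : P x = x) (hy : P y = 0) : Disj x y := by
  have hu0 : 0 ≤ |x| ⊓ |y| := le_inf (abs_nonneg x) (abs_nonneg y)
  have h1 : |y| ≤ (1 - P) |y| := by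
    simpa [hy] using abs_le_of_nonneg_hom hP.compl.nonneg y
  have h2 : |x| ≤ P |x| := by simpa [hx] using abs_le_of_nonneg_hom hP.nonneg x
  have h3 : P (|x| ⊓ |y|) ≤ 0 := by
    have := hP.mono ((inf_le_right : |x| ⊓ |y| ≤ |y|).trans h1)
    simpa [hP.idem] using this
  have h4 : (1 - P) (|x| ⊓ |y|) ≤ 0 := by
    have := hP.compl.mono ((inf_le_left : |x| ⊓ |y| ≤ |x|).trans h2)
    simpa [hP.idem] using this
  refine le_antisymm ?_ hu0
  have := add_le_add h3 h4
  simpa using this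

theorem abs_le (hP : IsBandProj P) (x : E) : |P x| ≤ |x| :=
  (abs_le_of_nonneg_hom hP.nonneg x).trans (hP.le_self (abs_nonneg x))

variable [HasSolidNorm E]

theorem norm_apply_le (hP : IsBandProj P) (x : E) : ‖P x‖ ≤ ‖x‖ :=
  HasSolidNorm.solid (hP.abs_le x)

/-- The reflection `P - (1 - P)` is a contraction. -/
theorem norm_reflection_le (hP : IsBandProj P) : ‖P - (1 - P)‖ ≤ 1 := by
  refine ContinuousLinearMap.opNorm_le_bound _ zero_le_one fun x => ?_
  rw [one_mul]
  refine HasSolidNorm.solid ?_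
  calc |P x - (1 - P) x| ≤ |P x| + |(1 - P) x| := abs_sub_le_abs_add_abs _ _
    _ ≤ P |x| + (1 - P) |x| := add_le_add (abs_le_of_nonneg_hom hP.nonneg x)
        (abs_le_of_nonneg_hom hP.compl.nonneg x)
    _ = |x| := by simp

end IsBandProj

variable [HasSolidNorm E]

/-- The projection onto the band generated by a solid cone of positive elements. -/
theorem exists_bandProj [CompleteSpace E] (hE : OrderContinuousNorm E) {V : Set E}
    (h0 : (0 : E) ∈ V) (hpos : ∀ v ∈ V, 0 ≤ v) (hsol : ∀ v ∈ V, ∀ w, 0 ≤ w → w ≤ v → w ∈ V)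
    (hadd : ∀ v ∈ V, ∀ w ∈ V, v + w ∈ V) :
    ∃ P : E →L[ℝ] E, IsBandProj P ∧
      (∀ ⦃x⦄, 0 ≤ x → IsLUB (V ∩ Set.Iic x) (P x) ∧ P x ∈ closure (V ∩ Set.Iic x)) ∧
      (∀ v ∈ V, P v = v) ∧ ∀ ⦃x⦄, 0 ≤ x → ∀ v ∈ V, v ≤ (1 - P) x → v = 0 := by
  have hex : ∀ x : E, 0 ≤ x → ∃ a, IsLUB (V ∩ Set.Iic x) a ∧ a ∈ closure (V ∩ Set.Iic x) := by
    intro x hx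
    refine exists_isLUB_mem_closure hE ⟨0, h0, hx⟩ ?_ ⟨x, fun v hv => hv.2⟩
    rintro v ⟨hv, hvx⟩ w ⟨hw, hwx⟩
    refine ⟨v ⊔ w, ⟨hsol _ (hadd v hv w hw) _ ((hpos v hv).trans le_sup_left) ?_,
      sup_le hvx hwx⟩, le_sup_left, le_sup_right⟩
    exact sup_le (le_add_of_nonneg_right (hpos w hw)) (le_add_of_nonneg_left (hpos v hv))
  choose! q hq using hex
  have hq0 : ∀ x, 0 ≤ x → 0 ≤ q x := fun x hx => (hq x hx).1.1 ⟨h0, hx⟩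
  have hqle : ∀ x, 0 ≤ x → q x ≤ x := fun x hx => (hq x hx).1.2 fun v hv => hv.2
  have hqadd : ∀ x y, 0 ≤ x → 0 ≤ y → q (x + y) = q x + q y := by
    intro x y hx hy
    refine (hq _ (add_nonneg hx hy)).1.unique ⟨?_, fun u hu => ?_⟩
    · rintro v ⟨hv, hvxy⟩
      have hv0 := hpos v hv
      have h1 : v ⊓ x ∈ V ∩ Set.Iic x :=
        ⟨hsol v hv _ (le_inf hv0 hx) inf_le_left, inf_le_right⟩
      have h2 : v - v ⊓ x ∈ V ∩ Set.Iic y := by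
        refine ⟨hsol v hv _ (sub_nonneg.2 inf_le_left) (sub_le_self _ (le_inf hv0 hx)), ?_⟩
        rw [Set.mem_Iic, sub_le_iff_le_add, ← sub_le_iff_le_add']
        exact le_inf (sub_le_self _ hy) (sub_le_iff_le_add.2 hvxy)
      have := add_le_add ((hq x hx).1.1 h1) ((hq y hy).1.1 h2)
      rwa [add_sub_cancel] at this
    · refine le_sub_iff_add_le'.1 ((hq y hy).1.2 fun w hw => le_sub_comm.1 ?_)
      refine (hq x hx).1.2 fun v hv => le_sub_iff_add_le.2 (hu ⟨hadd v hv.1 w hw.1, ?_⟩)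
      exact add_le_add hv.2 hw.2
  have hqsub : ∀ a b c d, 0 ≤ a → 0 ≤ b → 0 ≤ c → 0 ≤ d → a - b = c - d →
      q a - q b = q c - q d := by
    intro a b c d ha hb hc hd h
    rw [sub_eq_sub_iff_add_eq_add] at h ⊢
    rw [← hqadd a d ha hd, ← hqadd c b hc hb, h]
  let g : E →+ E := AddMonoidHom.mk' (fun x => q x⁺ - q x⁻) fun x y => by
    have := hqsub (x + y)⁺ (x + y)⁻ (x⁺ + y⁺) (x⁻ + y⁻) (posPart_nonneg _) (negPart_nonneg _)
      (add_nonneg (posPart_nonneg _) (posPart_nonneg _))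
      (add_nonneg (negPart_nonneg _) (negPart_nonneg _))
      (by rw [posPart_sub_negPart, add_sub_add_comm, posPart_sub_negPart, posPart_sub_negPart])
    rw [this, hqadd _ _ (posPart_nonneg _) (posPart_nonneg _),
      hqadd _ _ (negPart_nonneg _) (negPart_nonneg _), add_sub_add_comm]
  have hg : ∀ x, 0 ≤ x → g x = q x := by
    intro x hx
    have hqz : q 0 = 0 := le_antisymm (hqle 0 le_rfl) (hq0 0 le_rfl)
    change q x⁺ - q x⁻ = q x
    rw [posPart_of_nonneg hx, negPart_of_nonneg hx, hqz, sub_zero]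
  have hgnorm : ∀ x, ‖g x‖ ≤ 1 * ‖x‖ := by
    intro x
    rw [one_mul]
    refine HasSolidNorm.solid ?_
    calc |q x⁺ - q x⁻| ≤ |q x⁺| + |q x⁻| := abs_sub_le_abs_add_abs _ _
      _ = q x⁺ + q x⁻ := by
        rw [abs_of_nonneg (hq0 _ (posPart_nonneg x)), abs_of_nonneg (hq0 _ (negPart_nonneg x))]
      _ ≤ x⁺ + x⁻ := add_le_add (hqle _ (posPart_nonneg x)) (hqle _ (negPart_nonneg x))
      _ = |x| := posPart_add_negPart x
  let P : E →L[ℝ] E := g.toRealLinearMap (AddMonoidHomClass.continuous_of_bound g 1 hgnorm)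
  have hP : ∀ x, 0 ≤ x → P x = q x := hg
  have hqV : ∀ v ∈ V, q v = v := fun v hv =>
    le_antisymm (hqle v (hpos v hv)) ((hq v (hpos v hv)).1.1 ⟨hv, le_refl v⟩)
  have hqq : ∀ x, 0 ≤ x → q (q x) = q x := by
    intro x hx
    refine le_antisymm (hqle _ (hq0 x hx)) ((hq x hx).1.2 fun v hv => ?_)
    exact (hq _ (hq0 x hx)).1.1 ⟨hv.1, (hq x hx).1.1 hv⟩
  refine ⟨P, ⟨fun x => ?_, fun x hx => (hP x hx).symm ▸ hq0 x hx,
    fun x hx => (hP x hx).symm ▸ hqle x hx⟩, fun x hx => (hP x hx).symm ▸ hq x hx,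
    fun v hv => (hP v (hpos v hv)).trans (hqV v hv), ?_⟩
  · rw [← posPart_sub_negPart x]
    simp only [map_sub]
    rw [hP _ (posPart_nonneg x), hP _ (negPart_nonneg x), hP _ (hq0 _ (posPart_nonneg x)),
      hP _ (hq0 _ (negPart_nonneg x)), hqq _ (posPart_nonneg x), hqq _ (negPart_nonneg x)]
  · intro x hx v hv hvx
    rw [sub_apply, one_apply_eq_self, hP x hx] at hvx
    refine le_antisymm ?_ (hpos v hv)
    have : q x ≤ q x - v := (hq x hx).1.2 fun w hw => le_sub_iff_add_le.2
      ((hq x hx).1.1 ⟨hadd w hw.1 v hv, (add_le_add_left ((hq x hx).1.1 hw) v).trans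
        (le_sub_iff_add_le'.1 hvx)⟩)
    simpa using this

end Projection


/-! ### Hahn and Jordan decompositions of functionals -/

section Dual

variable {E : Type*} [NormedAddCommGroup E] [NormedSpace ℝ E] [Lattice E]

/-- Positivity of a functional. -/
def DualNonneg (φ : E →L[ℝ] ℝ) : Prop := ∀ ⦃x : E⦄, 0 ≤ x → 0 ≤ φ x

theorem DualNonneg.comp {φ : E →L[ℝ] ℝ} (hφ : DualNonneg φ) {P : E →L[ℝ] E}
    (hP : IsBandProj P) : DualNonneg (φ.comp P) := fun _ hx => hφ (hP.nonneg hx)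

variable [IsOrderedAddMonoid E]

theorem eq_zero_of_dualNonneg {φ : E →L[ℝ] ℝ} (h₁ : DualNonneg φ) (h₂ : DualNonneg (-φ)) :
    φ = 0 := by
  have h : ∀ x, 0 ≤ x → φ x = 0 := fun x hx =>
    le_antisymm (neg_nonneg.1 (h₂ hx)) (h₁ hx)
  ext x
  rw [← posPart_sub_negPart x, map_sub, h _ (posPart_nonneg x), h _ (negPart_nonneg x)]
  simp

variable [HasSolidNorm E]

theorem norm_le_of_dualNonneg {χ φ : E →L[ℝ] ℝ} (hχ : DualNonneg χ) (h : DualNonneg (φ - χ)) :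
    ‖χ‖ ≤ ‖φ‖ := by
  refine ContinuousLinearMap.opNorm_le_bound _ (norm_nonneg _) fun x => ?_
  have h1 : 0 ≤ φ |x| - χ |x| := h (abs_nonneg x)
  have h2 : 0 ≤ χ (|x| - x) := hχ (sub_nonneg.2 (le_abs_self x))
  have h3 : 0 ≤ χ (|x| + x) := hχ (by simpa using sub_nonneg.2 (neg_le_abs x))
  have h4 : φ |x| ≤ ‖φ‖ * ‖x‖ := by
    rw [← norm_abs_eq_norm x]
    exact (le_abs_self _).trans (φ.le_opNorm _)
  rw [map_sub] at h2
  rw [map_add] at h3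
  rw [Real.norm_eq_abs]
  exact abs_le.2 ⟨by linarith, by linarith⟩

variable [CompleteSpace E]

/-- For a set `F` of functionals, the projection onto the band generated by the elements `v ≥ 0`
such that all members of `F` are nonnegative on the order interval `[0, v]`. -/
theorem exists_bandProj_of_functionals (hE : OrderContinuousNorm E) (F : Set (E →L[ℝ] ℝ)) :
    ∃ P : E →L[ℝ] E, IsBandProj P ∧ (∀ f ∈ F, ∀ ⦃x⦄, 0 ≤ x → 0 ≤ f (P x)) ∧
      ∀ v, 0 ≤ v → (∀ f ∈ F, ∀ w, 0 ≤ w → w ≤ v → 0 ≤ f w) →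
        P v = v ∧ ∀ ⦃x⦄, 0 ≤ x → v ≤ (1 - P) x → v = 0 := by
  obtain ⟨P, hP, hlub, hfix, hdis⟩ := exists_bandProj hE
    (V := {v | 0 ≤ v ∧ ∀ f ∈ F, ∀ w, 0 ≤ w → w ≤ v → 0 ≤ f w})
    ⟨le_rfl, fun f _ w h0 h1 => by simp [le_antisymm h1 h0]⟩ (fun v hv => hv.1)
    (fun v hv w h0 h1 => ⟨h0, fun f hf u hu0 hu => hv.2 f hf u hu0 (hu.trans h1)⟩)
    (fun v hv w hw => ⟨add_nonneg hv.1 hw.1, fun f hf u hu0 hu => by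
      have h1 := hv.2 f hf (u ⊓ v) (le_inf hu0 hv.1) inf_le_right
      have h2 := hw.2 f hf (u - u ⊓ v) (sub_nonneg.2 inf_le_left) (by
        rw [sub_le_iff_le_add, ← sub_le_iff_le_add']
        exact le_inf (sub_le_self _ hw.1) (sub_le_iff_le_add.2 hu))
      rw [map_sub] at h2
      linarith⟩)
  refine ⟨P, hP, fun f hf x hx => ?_, fun v hv0 hv => ⟨hfix v ⟨hv0, hv⟩, fun x hx hvx =>
    hdis hx v ⟨hv0, hv⟩ hvx⟩⟩
  have hcl : IsClosed {z | 0 ≤ f z} := isClosed_le continuous_const f.continuous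
  exact closure_minimal (fun v hv => hv.1.2 f hf v hv.1.1 le_rfl) hcl (hlub hx).2

/-- The projection onto the band generated by a positive element. -/
theorem exists_bandProj_principal (hE : OrderContinuousNorm E) {y : E} (hy : 0 ≤ y) :
    ∃ P : E →L[ℝ] E, IsBandProj P ∧ P y = y ∧
      ∀ f : E →L[ℝ] ℝ, (∀ w, 0 ≤ w → w ≤ y → 0 ≤ f w) → DualNonneg (f.comp P) := by
  obtain ⟨P, hP, hF, hV⟩ := exists_bandProj_of_functionals hE
    {f | ∀ w, 0 ≤ w → w ≤ y → 0 ≤ f w}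
  exact ⟨P, hP, (hV y hy fun f hf => hf).1, fun f hf x hx => hF f hf hx⟩

/-- The Hahn decomposition of a functional. -/
theorem exists_hahn (hE : OrderContinuousNorm E) (f : E →L[ℝ] ℝ) :
    ∃ Q : E →L[ℝ] E, IsBandProj Q ∧ DualNonneg (f.comp Q) ∧ DualNonneg (-f.comp (1 - Q)) := by
  obtain ⟨Q, hQ, hF, hV⟩ := exists_bandProj_of_functionals hE {f}
  refine ⟨Q, hQ, fun x hx => hF f rfl hx, fun x hx => ?_⟩
  by_contra! hneg
  have hpos : 0 < f ((1 - Q) x) := by simpa using hneg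
  -- A strictly positive piece of `(1 - Q) x` would belong to the family generating the band of `Q`,
  -- so it must be `0`.
  obtain ⟨y, hy0, hyx, hfy, hy⟩ := exists_strictly_pos_below hE f (hQ.compl.nonneg hx)
  have := (hV y hy0 (by
    rintro _ rfl w hw0 hwy
    rcases eq_or_ne w 0 with rfl | hne
    · simp
    · exact (hy w hw0 hwy hne).le)).2 hx hyx
  rw [this, map_zero] at hfy
  linarith

/-- The sum of the two parts is `φ` composed with a reflection, which is a contraction. -/
theorem exists_sub_eq_norm_add_le (hE : OrderContinuousNorm E) (φ : E →L[ℝ] ℝ) :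
    ∃ φ₁ φ₂ : E →L[ℝ] ℝ, DualNonneg φ₁ ∧ DualNonneg φ₂ ∧ φ = φ₁ - φ₂ ∧ ‖φ₁ + φ₂‖ ≤ ‖φ‖ := by
  obtain ⟨Q, hQ, h1, h2⟩ := exists_hahn hE φ
  refine ⟨_, _, h1, h2, by ext x; simp, ?_⟩
  have : φ.comp Q + -φ.comp (1 - Q) = φ.comp (Q - (1 - Q)) := by
    ext x
    simp
    ring
  rw [this]
  exact (ContinuousLinearMap.opNorm_comp_le _ _).trans
    (mul_le_of_le_one_right (norm_nonneg _) hQ.norm_reflection_le)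

/-- Every element is normed, up to a factor at most one, by a positive functional. -/
theorem exists_dualNonneg_norm_le (hE : OrderContinuousNorm E) {x : E} (hx : 0 ≤ x) :
    ∃ φ : E →L[ℝ] ℝ, DualNonneg φ ∧ ‖φ‖ ≤ 1 ∧ ‖x‖ ≤ φ x := by
  obtain ⟨g, hg1, hgx⟩ := exists_dual_vector'' ℝ x
  obtain ⟨φ₁, φ₂, h1, h2, rfl, h⟩ := exists_sub_eq_norm_add_le hE g
  refine ⟨φ₁ + φ₂, fun z hz => add_nonneg (h1 hz) (h2 hz), h.trans hg1, ?_⟩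
  have h2x := h2 hx
  simp only [RCLike.ofReal_real_eq_id, id, sub_apply] at hgx
  rw [← hgx, add_apply]
  linarith

end Dual

/-! ### Hahn decomposition of local bilinear forms -/

section Local

variable {E : Type*} [NormedAddCommGroup E] [NormedSpace ℝ E] [Lattice E]

/-- A bilinear form on `E × E*` is local if band projections may be moved between its arguments. -/
def IsLocal (D : E →L[ℝ] (E →L[ℝ] ℝ) →L[ℝ] ℝ) : Prop :=
  ∀ ⦃P : E →L[ℝ] E⦄, IsBandProj P → ∀ x φ, D (P x) φ = D x (φ.comp P)

variable [IsOrderedAddMonoid E] [HasSolidNorm E] [CompleteSpace E]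
  {D : E →L[ℝ] (E →L[ℝ] ℝ) →L[ℝ] ℝ}

/-- Approximation of a functional `φ ≤ (m * η) φ₀` by a combination of the functionals `φ₀ ∘ Q`. -/
theorem IsLocal.exists_approx (hE : OrderContinuousNorm E) (hD : IsLocal D) {y : E} {η : ℝ}
    (hη : 0 ≤ η) (m : ℕ) :
    ∀ φ₀ φ : E →L[ℝ] ℝ, DualNonneg φ₀ → (∀ w, 0 ≤ w → w ≤ y → 0 ≤ D w φ₀) → DualNonneg φ →
      DualNonneg ((m * η) • φ₀ - φ) →
      ∃ ψ, DualNonneg (φ - ψ) ∧ DualNonneg (η • φ₀ - (φ - ψ)) ∧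
        ∀ w, 0 ≤ w → w ≤ y → 0 ≤ D w ψ := by
  induction m with
  | zero =>
    intro φ₀ φ hφ₀ _ hφ hle
    refine ⟨0, by simpa using hφ, fun x hx => ?_, by simp⟩
    have h1 := hle hx
    have h2 := mul_nonneg hη (hφ₀ hx)
    simp at h1 ⊢
    linarith
  | succ m ih =>
    intro φ₀ φ hφ₀ hD₀ hφ hle
    -- On the range of `Q`, `φ` lies between `(m * η) • φ₀` and `((m + 1) * η) • φ₀`, so the lower
    -- value serves as approximant; on the complement the bound drops to `m * η` and induction
    -- applies to `φ₀ ∘ (1 - Q)`.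
    obtain ⟨Q, hQ, hpos, hneg⟩ := exists_hahn hE (φ - (m * η) • φ₀)
    obtain ⟨ψ, h1, h2, h3⟩ := ih (φ₀.comp (1 - Q)) (φ.comp (1 - Q)) (hφ₀.comp hQ.compl)
      (fun w hw0 hwy => by
        rw [← hD hQ.compl]
        exact hD₀ _ (hQ.compl.nonneg hw0) ((hQ.compl.le_self hw0).trans hwy))
      (hφ.comp hQ.compl) (fun x hx => by
        have := hneg hx
        simp at this ⊢
        linarith)
    refine ⟨ψ + (m * η) • φ₀.comp Q, fun x hx => ?_, fun x hx => ?_, fun w hw0 hwy => ?_⟩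
    · have e1 := h1 hx
      have e2 := hpos hx
      simp at e1 e2 ⊢
      linarith
    · have e1 := h2 hx
      have e2 := hle (hQ.nonneg hx)
      simp at e1 e2 ⊢
      linarith
    · have e1 := hD₀ _ (hQ.nonneg hw0) ((hQ.le_self hw0).trans hwy)
      rw [map_add, map_smul, ← hD hQ]
      exact add_nonneg (h3 w hw0 hwy) (mul_nonneg (by positivity) e1)

/-- Positivity passes from `φ₀` to its step combinations by locality, and these approximate `φ` in
norm with mesh `n / N → 0`. -/
theorem IsLocal.nonneg_of_le_smul (hE : OrderContinuousNorm E) (hD : IsLocal D) {y : E}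
    (hy : 0 ≤ y) {φ₀ φ : E →L[ℝ] ℝ} (hφ₀ : DualNonneg φ₀)
    (hD₀ : ∀ w, 0 ≤ w → w ≤ y → 0 ≤ D w φ₀) (hφ : DualNonneg φ) {n : ℕ}
    (hle : DualNonneg ((n : ℝ) • φ₀ - φ)) : 0 ≤ D y φ := by
  refine le_of_forall_pos_le_add fun δ hδ => ?_
  obtain ⟨N, hN⟩ := exists_nat_gt (‖D y‖ * (n * ‖φ₀‖) / δ)
  have hN0 : (0 : ℝ) < N := lt_of_le_of_lt (by positivity) hN
  have hη : (0 : ℝ) ≤ n / N := by positivity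
  obtain ⟨ψ, h1, h2, h3⟩ := hD.exists_approx hE hη N φ₀ φ hφ₀ hD₀ hφ
    (by rwa [mul_div_cancel₀ _ hN0.ne'])
  have h4 := norm_le_of_dualNonneg h1 h2
  have h5 := (D y).le_opNorm (φ - ψ)
  have h6 : ‖D y‖ * ‖φ - ψ‖ ≤ δ := by
    calc ‖D y‖ * ‖φ - ψ‖ ≤ ‖D y‖ * ‖((n : ℝ) / N) • φ₀‖ := by gcongr
      _ = ‖D y‖ * (n * ‖φ₀‖) / N := by
        rw [norm_smul, Real.norm_of_nonneg hη]; ring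
      _ ≤ δ := by
        rw [div_le_iff₀ hN0]
        rw [div_lt_iff₀ hδ] at hN
        linarith
  have h7 := neg_le_of_abs_le (h5.trans h6)
  rw [map_sub] at h7
  linarith [h3 y hy le_rfl]

/-- The Hahn decomposition of a local bilinear form. -/
theorem IsLocal.exists_hahn (hE : OrderContinuousNorm E) (hD : IsLocal D) :
    ∃ P : E →L[ℝ] E, IsBandProj P ∧ ∀ ⦃x⦄, 0 ≤ x → ∀ ⦃φ⦄, DualNonneg φ →
      0 ≤ D (P x) φ ∧ D ((1 - P) x) φ ≤ 0 := by
  obtain ⟨P, hP, hF, hV⟩ := exists_bandProj_of_functionals hE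
    {f | ∃ φ, DualNonneg φ ∧ f = D.flip φ}
  refine ⟨P, hP, fun x hx φ₀ hφ₀ => ⟨hF _ ⟨φ₀, hφ₀, rfl⟩ hx, ?_⟩⟩
  by_contra! hpos
  obtain ⟨x₁, hx₁0, hx₁, hDx₁, hx₁pos⟩ :=
    exists_strictly_pos_below hE (D.flip φ₀) (hP.compl.nonneg hx)
  simp only [ContinuousLinearMap.flip_apply] at hDx₁ hx₁pos
  have hx₁0' := (hV x₁ hx₁0 ?_).2 hx hx₁
  · rw [hx₁0', map_zero, zero_apply] at hDx₁
    linarith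
  rintro _ ⟨φ, hφ, rfl⟩ w hw0 hwx
  rw [ContinuousLinearMap.flip_apply]
  by_contra! hneg
  obtain ⟨y, hy0, hyw, hDy, hypos⟩ := exists_strictly_pos_below hE (-D.flip φ) hw0
  simp only [neg_apply, ContinuousLinearMap.flip_apply] at hDy hypos
  have hyne : y ≠ 0 := by
    rintro rfl
    simp at hDy
    linarith
  -- If `φ₀ y = 0`, then `φ₀` vanishes on the band of `y`, and locality gives `D y φ₀ = 0`.
  have hφ₀y : 0 < φ₀ y := by
    refine lt_of_le_of_ne (hφ₀ hy0) fun h0 => ?_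
    obtain ⟨P, hP, hPy, hPf⟩ := exists_bandProj_principal hE hy0
    have hz : φ₀.comp P = 0 := by
      refine eq_zero_of_dualNonneg (hφ₀.comp hP) ?_
      refine hPf (-φ₀) fun v hv0 hvy => ?_
      have : 0 ≤ φ₀ (y - v) := hφ₀ (sub_nonneg.2 hvy)
      rw [map_sub] at this
      rw [neg_apply]
      linarith
    have := hx₁pos y hy0 (hyw.trans hwx) hyne
    rw [← hPy, hD hP, hz, map_zero] at this
    exact lt_irrefl _ this
  obtain ⟨n, hn⟩ := exists_nat_gt (φ y / φ₀ y)
  rw [div_lt_iff₀ hφ₀y] at hn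
  -- On the band of `z`, `φ` is dominated by `n • φ₀`, so `D z φ ≥ 0`, against the strict negativity
  -- of `D · φ` on `[0, y]`.
  obtain ⟨z, hz0, hzy, hfz, hzpos⟩ := exists_strictly_pos_below hE ((n : ℝ) • φ₀ - φ) hy0
  have hzne : z ≠ 0 := by
    rintro rfl
    simp at hfz
    linarith
  obtain ⟨Q, hQ, hQz, hQf⟩ := exists_bandProj_principal hE hz0
  have h1 : 0 ≤ D z (φ.comp Q) := by
    refine hD.nonneg_of_le_smul hE hz0 (hφ₀.comp hQ) (fun v hv0 hvz => ?_) (hφ.comp hQ)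
      (n := n) (hQf ((n : ℝ) • φ₀ - φ) fun v hv0 hvz => ?_)
    · rw [← hD hQ]
      rcases eq_or_ne (Q v) 0 with h | h
      · simp [h]
      · exact (hx₁pos _ (hQ.nonneg hv0) ((((hQ.le_self hv0).trans hvz).trans hzy).trans
          (hyw.trans hwx)) h).le
    · rcases eq_or_ne v 0 with rfl | h
      · simp
      · exact (hzpos v hv0 hvz h).le
  rw [← hD hQ, hQz] at h1
  linarith [hypos z hz0 hzy hzne]

end Local


/-! ### Averaging over reflections -/

section Averaging

variable {E : Type*} [NormedAddCommGroup E] [NormedSpace ℝ E] [Lattice E] [IsOrderedAddMonoid E]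
  {P Q T S : E →L[ℝ] E}

/-- This is the projection whose reflection is the product of those of `P` and `Q`, so the set of
conjugates is stable under further conjugation. -/
theorem IsBandProj.xnor (hP : IsBandProj P) (hQ : IsBandProj Q) :
    IsBandProj (P * Q + (1 - P) * (1 - Q)) where
  idem x := by
    simp only [add_apply, mul_apply_eq_comp, sub_apply, one_apply_eq_self, map_add,
      map_sub, hP.idem, hQ.idem, hQ.comm_apply hP]
    abel
  nonneg x hx := add_nonneg (hP.nonneg (hQ.nonneg hx)) (hP.compl.nonneg (hQ.compl.nonneg hx))
  le_self x hx := by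
    have h1 := hP.nonneg (hQ.compl.nonneg hx)
    have h2 := hP.compl.nonneg (hQ.nonneg hx)
    have h := add_nonneg h1 h2
    rw [← sub_nonneg]
    convert h using 1
    simp
    abel

/-- The conjugates of `T` by the reflections `P - (1 - P)`. -/
def reflectionConj (T : E →L[ℝ] E) : Set (E →L[ℝ] E) :=
  {S | ∃ P : E →L[ℝ] E, IsBandProj P ∧ S = (P - (1 - P)) * T * (P - (1 - P))}

omit [Lattice E] [IsOrderedAddMonoid E] in
theorem reflection_mul (P Q : E →L[ℝ] E) :
    (P - (1 - P)) * (Q - (1 - Q)) =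
      (P * Q + (1 - P) * (1 - Q)) - (1 - (P * Q + (1 - P) * (1 - Q))) := by
  noncomm_ring

theorem conj_mem_convexHull (hP : IsBandProj P) (hS : S ∈ convexHull ℝ (reflectionConj T)) :
    (P - (1 - P)) * S * (P - (1 - P)) ∈ convexHull ℝ (reflectionConj T) := by
  let L : (E →L[ℝ] E) →ₗ[ℝ] (E →L[ℝ] E) :=
    LinearMap.mulLeft ℝ (P - (1 - P)) ∘ₗ LinearMap.mulRight ℝ (P - (1 - P))
  have h1 : L S ∈ L '' convexHull ℝ (reflectionConj T) := ⟨S, hS, rfl⟩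
  rw [L.image_convexHull] at h1
  rw [mul_assoc]
  refine convexHull_mono ?_ h1
  rintro _ ⟨_, ⟨Q, hQ, rfl⟩, rfl⟩
  refine ⟨_, hP.xnor hQ, ?_⟩
  have hPQ : Commute (P - (1 - P)) (Q - (1 - Q)) := by
    have h1 : Commute P (Q - (1 - Q)) :=
      (hP.commute hQ).sub_right ((Commute.one_right P).sub_right (hP.commute hQ))
    exact h1.sub_left ((Commute.one_left _).sub_left h1)
  rw [← reflection_mul]
  calc (P - (1 - P)) * ((Q - (1 - Q)) * T * (Q - (1 - Q)) * (P - (1 - P)))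
      = (P - (1 - P)) * (Q - (1 - Q)) * T * ((Q - (1 - Q)) * (P - (1 - P))) := by
        simp only [mul_assoc]
    _ = _ := by rw [hPQ.symm.eq]

/-- The block diagonal part is the midpoint of `S` and its conjugate. -/
theorem average_mem_convexHull (hP : IsBandProj P) (hS : S ∈ convexHull ℝ (reflectionConj T)) :
    P * S * P + (1 - P) * S * (1 - P) ∈ convexHull ℝ (reflectionConj T) := by
  have h := convex_convexHull ℝ (reflectionConj T) hS (conj_mem_convexHull hP hS)
    (a := 1 / 2) (b := 1 / 2) (by norm_num) (by norm_num) (by norm_num)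
  convert h using 1
  ext x
  simp
  module

theorem exists_mem_convexHull_commute (T : E →L[ℝ] E)
    (F : Finset {P : E →L[ℝ] E // IsBandProj P}) :
    ∃ S ∈ convexHull ℝ (reflectionConj T), ∀ P ∈ F, Commute S P.1 := by
  classical
  induction F using Finset.induction_on with
  | empty =>
    refine ⟨T, subset_convexHull ℝ _ ⟨1, isBandProj_one, by simp⟩, by simp⟩
  | insert P F _ ih =>
    obtain ⟨S, hS, hSF⟩ := ih
    -- Band projections commute, so compressing by `P` preserves the commutation already obtained
    -- for `F`.
    refine ⟨_, average_mem_convexHull P.2 hS, fun Q hQ => ?_⟩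
    have hPQ := P.2.commute Q.2
    rcases Finset.mem_insert.1 hQ with rfl | hQF
    · refine ContinuousLinearMap.ext fun x => ?_
      simp [Q.2.idem]
    · have hc := (Commute.one_left Q.1).sub_left hPQ
      exact ((hPQ.mul_left (hSF Q hQF)).mul_left hPQ).add_left
        ((hc.mul_left (hSF Q hQF)).mul_left hc)

variable [HasSolidNorm E] {ε : ℝ}

theorem norm_le_of_mem_convexHull (hS : S ∈ convexHull ℝ (reflectionConj T)) : ‖S‖ ≤ ‖T‖ := by
  have : reflectionConj T ⊆ Metric.closedBall 0 ‖T‖ := by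
    rintro _ ⟨P, hP, rfl⟩
    rw [mem_closedBall_zero_iff]
    have h := hP.norm_reflection_le
    calc _ ≤ ‖(P - (1 - P)) * T‖ * ‖P - (1 - P)‖ := norm_mul_le _ _
      _ ≤ ‖P - (1 - P)‖ * ‖T‖ * ‖P - (1 - P)‖ := by gcongr; exact norm_mul_le _ _
      _ ≤ 1 * ‖T‖ * 1 := by gcongr
      _ = ‖T‖ := by ring
  simpa using convexHull_min this (convex_closedBall _ _) hS

/-- The test element `(1 - P) |T (P x)|` is disjoint from `P x` and lies below `|T (P x)|`. -/
theorem norm_offDiag_le (hT : AlmostBandPreserving ε (T : E →ₗ[ℝ] E)) (hP : IsBandProj P) (x : E) :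
    ‖(1 - P) (T (P x))‖ ≤ ε * ‖P x‖ := by
  set y := (1 - P) |T (P x)| with hy
  have hy0 : 0 ≤ y := hP.compl.nonneg (abs_nonneg _)
  have hPy : P y = 0 := by simp [hy, hP.idem]
  have h := hT (P x) y hy0 (by
    have := hP.disj (hP.idem x) hPy
    rwa [Disj, inf_comm] at this)
  have h1 : |T (P x)| ⊓ y = y := inf_eq_right.2 (hP.compl.le_self (abs_nonneg _))
  rw [ContinuousLinearMap.coe_coe, h1] at h
  refine le_trans (HasSolidNorm.solid ?_) h
  rw [abs_of_nonneg hy0]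
  exact abs_le_of_nonneg_hom hP.compl.nonneg _

/-- The constant is `2 * (ε + ε)`: `T` minus a conjugate is twice the sum of the two off-diagonal
blocks. -/
theorem norm_sub_le_of_mem_convexHull (hε : 0 ≤ ε)
    (hT : AlmostBandPreserving ε (T : E →ₗ[ℝ] E))
    (hS : S ∈ convexHull ℝ (reflectionConj T)) : ‖T - S‖ ≤ 4 * ε := by
  have : reflectionConj T ⊆ Metric.closedBall T (4 * ε) := by
    rintro _ ⟨P, hP, rfl⟩
    rw [mem_closedBall_iff_norm']
    refine ContinuousLinearMap.opNorm_le_bound _ (by positivity) fun x => ?_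
    have h1 : ‖(1 - P) (T (P x))‖ ≤ ε * ‖x‖ := (norm_offDiag_le hT hP x).trans
      (mul_le_mul_of_nonneg_left (hP.norm_apply_le x) hε)
    have h2 : ‖P (T ((1 - P) x))‖ ≤ ε * ‖x‖ := by
      have h := (norm_offDiag_le hT hP.compl x).trans
        (mul_le_mul_of_nonneg_left (hP.compl.norm_apply_le x) hε)
      rwa [sub_sub_cancel] at h
    have h3 : (T - (P - (1 - P)) * T * (P - (1 - P))) x =
        (2 : ℝ) • ((1 - P) (T (P x)) + P (T ((1 - P) x))) := by
      simp
      module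
    rw [h3, norm_smul, Real.norm_of_nonneg zero_le_two]
    linarith [norm_add_le ((1 - P) (T (P x))) (P (T ((1 - P) x)))]
  have h := convexHull_min this (convex_closedBall _ _) hS
  rwa [mem_closedBall_iff_norm'] at h

/-- The averages of `T` have a limit in the sense of bilinear forms on `E × E*`. -/
theorem exists_isLocal_limit (hε : 0 ≤ ε) (hT : AlmostBandPreserving ε (T : E →ₗ[ℝ] E)) :
    ∃ B : E →L[ℝ] (E →L[ℝ] ℝ) →L[ℝ] ℝ, IsLocal B ∧
      (∀ x φ, ‖B x φ‖ ≤ ‖T‖ * ‖x‖ * ‖φ‖) ∧ ∀ x φ, ‖φ (T x) - B x φ‖ ≤ 4 * ε * ‖x‖ * ‖φ‖ := by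
  choose S hS hcomm using exists_mem_convexHull_commute T
  let U : Ultrafilter (Finset {P : E →L[ℝ] E // IsBandProj P}) := Ultrafilter.of Filter.atTop
  have hU := Ultrafilter.of_le (Filter.atTop : Filter (Finset {P : E →L[ℝ] E // IsBandProj P}))
  have hbound : ∀ (R : E →L[ℝ] E) (c : ℝ), ‖R‖ ≤ c → ∀ x (φ : E →L[ℝ] ℝ),
      ‖φ (R x)‖ ≤ c * ‖x‖ * ‖φ‖ := fun R c hR x φ => by
    calc ‖φ (R x)‖ ≤ ‖φ‖ * ‖R x‖ := φ.le_opNorm _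
      _ ≤ ‖φ‖ * (c * ‖x‖) := by gcongr; exact R.le_of_opNorm_le hR x
      _ = c * ‖x‖ * ‖φ‖ := by ring
  have hSb : ∀ F x (φ : E →L[ℝ] ℝ), ‖φ (S F x)‖ ≤ ‖T‖ * ‖x‖ * ‖φ‖ := fun F =>
    hbound _ _ (norm_le_of_mem_convexHull (hS F))
  have hex : ∀ x (φ : E →L[ℝ] ℝ), ∃ b, Filter.Tendsto (fun F => φ (S F x)) U (nhds b) := by
    intro x φ
    obtain ⟨b, -, hb⟩ := (isCompact_closedBall (0 : ℝ) (‖T‖ * ‖x‖ * ‖φ‖)).ultrafilter_le_nhds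
      (U.map fun F => φ (S F x)) (by
        rw [Filter.le_principal_iff]
        exact Filter.mem_map.2 (Filter.Eventually.of_forall fun F =>
          mem_closedBall_zero_iff.2 (hSb F x φ)))
    exact ⟨b, hb⟩
  choose b hb using hex
  let B₀ : E →ₗ[ℝ] (E →L[ℝ] ℝ) →ₗ[ℝ] ℝ := LinearMap.mk₂ ℝ b
    (fun x y φ => tendsto_nhds_unique (hb _ _) (by simpa using (hb x φ).add (hb y φ)))
    (fun c x φ => tendsto_nhds_unique (hb _ _) (by simpa using (hb x φ).const_mul c))
    (fun x φ ψ => tendsto_nhds_unique (hb _ _) (by simpa using (hb x φ).add (hb x ψ)))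
    (fun c x φ => tendsto_nhds_unique (hb _ _) (by simpa using (hb x φ).const_mul c))
  have hb1 : ∀ x φ, ‖b x φ‖ ≤ ‖T‖ * ‖x‖ * ‖φ‖ := by
    intro x φ
    refine le_of_tendsto (hb x φ).norm (.of_forall fun F => ?_)
    exact hSb F x φ
  refine ⟨B₀.mkContinuous₂ ‖T‖ hb1, fun P hP x φ => ?_, hb1, fun x φ => ?_⟩
  · refine tendsto_nhds_unique (hb (P x) φ) ((hb x (φ.comp P)).congr' ?_)
    -- The ultrafilter refines `atTop`, so eventually `P ∈ F` and `S F` commutes with `P`.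
    filter_upwards [hU (Filter.eventually_ge_atTop {⟨P, hP⟩})] with F hF
    have h := hcomm F ⟨P, hP⟩ (hF (Finset.mem_singleton_self _))
    exact congrArg φ (DFunLike.congr_fun h.eq x).symm
  · refine le_of_tendsto ((hb x φ).const_sub (φ (T x))).norm (.of_forall fun F => ?_)
    rw [← map_sub]
    exact hbound (T - S F) _ (norm_sub_le_of_mem_convexHull hε hT (hS F)) x φ

end Averaging

/-! ### Local forms come from operators on `E` -/

section Representation

variable {E : Type*} [NormedAddCommGroup E] [NormedSpace ℝ E] [Lattice E]
  {B : E →L[ℝ] (E →L[ℝ] ℝ) →L[ℝ] ℝ}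

open NormedSpace in
theorem IsLocal.smul_inclusion_sub (hB : IsLocal B) (t s : ℝ) :
    IsLocal (t • inclusionInDoubleDual ℝ E + s • B) := fun P hP x φ => by
  simp [hB hP]

variable [IsOrderedAddMonoid E] [HasSolidNorm E] [CompleteSpace E]

/-- On the negative part `z` of `(‖B‖ + 1) • J - B`, a positive `ψ` norming `z` gives `(‖B‖ + 1) *
‖z‖ ≤ ‖B‖ * ‖z‖`, so `z = 0`. -/
theorem IsLocal.le_smul (hE : OrderContinuousNorm E) (hB : IsLocal B) {x : E} (hx : 0 ≤ x)
    {φ : E →L[ℝ] ℝ} (hφ : DualNonneg φ) : B x φ ≤ (‖B‖ + 1) * φ x := by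
  obtain ⟨P, hP, h⟩ := (hB.smul_inclusion_sub (‖B‖ + 1) (-1)).exists_hahn hE
  have h0 : (1 - P) x = 0 := by
    obtain ⟨ψ, hψ, hψ1, hψx⟩ := exists_dualNonneg_norm_le hE (hP.compl.nonneg hx)
    have h1 := (h hx hψ).2
    have h2 := (le_abs_self _).trans (B.le_opNorm₂ ((1 - P) x) ψ)
    set z := (1 - P) x
    simp only [add_apply, smul_apply, NormedSpace.dual_def, smul_eq_mul] at h1
    have h3 : ‖B‖ * ‖z‖ * ‖ψ‖ ≤ ‖B‖ * ‖z‖ * 1 := by gcongr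
    have h4 : (‖B‖ + 1) * ‖z‖ ≤ (‖B‖ + 1) * ψ z := by gcongr
    rw [← norm_eq_zero]
    exact le_antisymm (by linarith) (norm_nonneg _)
  have hPx : P x = x := by
    exact (sub_eq_zero.1 h0).symm
  have := (h hx hφ).1
  rw [hPx] at this
  simp only [add_apply, smul_apply, NormedSpace.dual_def, smul_eq_mul] at this
  linarith

/-- Peels off the top layer: where `B` exceeds the level `a + m * η`, that level is a value accurate
up to `η`; the remaining part of `x` has one layer fewer. -/
theorem IsLocal.exists_approx_apply (hE : OrderContinuousNorm E) (hB : IsLocal B) {a η : ℝ}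
    (hη : 0 ≤ η) (m : ℕ) : ∀ x : E, 0 ≤ x → (∀ φ : E →L[ℝ] ℝ, DualNonneg φ →
      a * φ x ≤ B x φ ∧ B x φ ≤ (a + m * η) * φ x) →
    ∃ s : E, ∀ φ : E →L[ℝ] ℝ, DualNonneg φ → 0 ≤ B x φ - φ s ∧ B x φ - φ s ≤ η * φ x := by
  induction m with
  | zero =>
    intro x hx h
    refine ⟨a • x, fun φ hφ => ?_⟩
    obtain ⟨h1, h2⟩ := h φ hφ
    have h3 := mul_nonneg hη (hφ hx)
    rw [Nat.cast_zero, zero_mul, add_zero] at h2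
    rw [map_smul, smul_eq_mul]
    exact ⟨by linarith, by linarith⟩
  | succ m ih =>
    intro x hx h
    obtain ⟨P, hP, hPt⟩ := (hB.smul_inclusion_sub (a + m * η) (-1)).exists_hahn hE
    obtain ⟨s, hs⟩ := ih (P x) (hP.nonneg hx) fun φ hφ => ⟨by
        simpa [hB hP] using (h _ (hφ.comp hP)).1, by
        have := (hPt hx hφ).1
        simp only [add_apply, smul_apply, NormedSpace.dual_def, smul_eq_mul] at this
        linarith⟩
    refine ⟨s + (a + m * η) • (1 - P) x, fun φ hφ => ?_⟩
    have h1 := hs φ hφ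
    have h2 := (hPt hx hφ).2
    have h3 := (h _ (hφ.comp hP.compl)).2
    rw [← hB hP.compl] at h3
    change B ((1 - P) x) φ ≤ _ * φ ((1 - P) x) at h3
    have h4 : B x φ = B (P x) φ + B ((1 - P) x) φ := by
      rw [← add_apply, ← map_add]; simp
    have h5 : φ x = φ (P x) + φ ((1 - P) x) := by rw [← map_add]; simp
    simp only [add_apply, smul_apply, NormedSpace.dual_def, smul_eq_mul] at h2
    rw [Nat.cast_succ] at h3
    rw [h4, h5, map_add, map_smul, smul_eq_mul]
    constructor <;> linarith

open NormedSpace in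
theorem IsLocal.mem_range (hE : OrderContinuousNorm E) (hB : IsLocal B) {x : E} (hx : 0 ≤ x) :
    B x ∈ (inclusionInDoubleDualLi ℝ (E := E)).toLinearMap.range := by
  have hcl : IsClosed (Set.range (inclusionInDoubleDualLi ℝ (E := E))) :=
    (inclusionInDoubleDualLi ℝ (E := E)).isometry.isClosedEmbedding.isClosed_range
  change B x ∈ Set.range (inclusionInDoubleDualLi ℝ (E := E))
  rw [← hcl.closure_eq, Metric.mem_closure_iff]
  intro δ hδ
  -- Length of the range of levels, from `-(‖-B‖ + 1)` to `‖B‖ + 1`, to be cut into `N` layers.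
  set M := ‖-B‖ + 1 + (‖B‖ + 1)
  have hM : 0 < M := by positivity
  obtain ⟨N, hN⟩ := exists_nat_gt (M * ‖x‖ / δ)
  have hN0 : (0 : ℝ) < N := lt_of_le_of_lt (by positivity) hN
  have hη : 0 < M / N := by positivity
  obtain ⟨s, hs⟩ := hB.exists_approx_apply hE (a := -(‖-B‖ + 1)) hη.le N x hx
    fun φ hφ => ⟨by
      have hnB : IsLocal (-B) := fun P hP x φ => by simp [hB hP]
      have := hnB.le_smul hE hx hφ
      simp only [neg_apply] at this
      linarith, by
      rw [mul_div_cancel₀ _ hN0.ne', neg_add_cancel_left]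
      exact hB.le_smul hE hx hφ⟩
  refine ⟨_, ⟨s, rfl⟩, ?_⟩
  rw [dist_eq_norm]
  refine lt_of_le_of_lt (b := M / N * ‖x‖) ?_ ?_
  · refine ContinuousLinearMap.opNorm_le_bound _ (by positivity) fun φ => ?_
    obtain ⟨φ₁, φ₂, h1, h2, rfl, h⟩ := exists_sub_eq_norm_add_le hE φ
    have e1 := hs φ₁ h1
    have e2 := hs φ₂ h2
    have e3 : φ₁ x + φ₂ x ≤ ‖φ₁ - φ₂‖ * ‖x‖ :=
      (le_abs_self _).trans ((φ₁ + φ₂).le_of_opNorm_le h x)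
    have e4 := mul_le_mul_of_nonneg_left e3 hη.le
    change ‖B x (φ₁ - φ₂) - (φ₁ - φ₂) s‖ ≤ _
    rw [map_sub, sub_apply, Real.norm_eq_abs]
    exact abs_le.2 ⟨by linarith, by linarith⟩
  · rw [div_lt_iff₀ hδ] at hN
    rw [div_mul_eq_mul_div, div_lt_iff₀ hN0]
    linarith

open NormedSpace in
/-- A local bilinear form on `E × E*` is induced by an operator on `E`. -/
theorem IsLocal.exists_operator (hE : OrderContinuousNorm E) (hB : IsLocal B) :
    ∃ R : E →L[ℝ] E, ∀ x (φ : E →L[ℝ] ℝ), φ (R x) = B x φ := by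
  let J := inclusionInDoubleDualLi ℝ (E := E)
  have hmem : ∀ x, B x ∈ J.toLinearMap.range := fun x => by
    rw [← posPart_sub_negPart x, map_sub]
    exact Submodule.sub_mem _ (hB.mem_range hE (posPart_nonneg x))
      (hB.mem_range hE (negPart_nonneg x))
  refine ⟨J.equivRange.symm.toContinuousLinearEquiv.toContinuousLinearMap.comp
    (B.codRestrict _ hmem), fun x φ => ?_⟩
  have h : J (J.equivRange.symm ⟨B x, hmem x⟩) = B x :=
    congrArg Subtype.val (J.equivRange.apply_symm_apply ⟨B x, hmem x⟩)
  exact DFunLike.congr_fun h φ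

end Representation

/-! ### Bands as ranges of band projections -/

section Bands

variable {E : Type*} [NormedAddCommGroup E] [NormedSpace ℝ E] [Lattice E] [IsOrderedAddMonoid E]
  [HasSolidNorm E] [CompleteSpace E]

theorem IsBand.exists_bandProj (hE : OrderContinuousNorm E) {Y : Submodule ℝ E} (hY : IsBand Y) :
    ∃ P : E →L[ℝ] E, IsBandProj P ∧ (∀ x, P x ∈ Y) ∧ ∀ x ∈ Y, P x = x := by
  obtain ⟨P, hP, hlub, hfix, -⟩ := BanachLattice.exists_bandProj hE (V := {v | 0 ≤ v ∧ v ∈ Y})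
    ⟨le_rfl, Y.zero_mem⟩ (fun v hv => hv.1)
    (fun v hv w h0 h1 => ⟨h0, hY.solid hv.2 (by rwa [abs_of_nonneg h0, abs_of_nonneg hv.1])⟩)
    (fun v hv w hw => ⟨add_nonneg hv.1 hw.1, Y.add_mem hv.2 hw.2⟩)
  have hmem : ∀ x, 0 ≤ x → P x ∈ Y := fun x hx =>
    hY.isLUB_mem (fun y hy => hy.1.2) (hlub hx).1
  refine ⟨P, hP, fun x => ?_, fun x hx => ?_⟩
  · rw [← posPart_sub_negPart x, map_sub]
    exact Y.sub_mem (hmem _ (posPart_nonneg x)) (hmem _ (negPart_nonneg x))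
  · have h1 : x⁺ ∈ Y := hY.solid hx (by
      rw [abs_of_nonneg (posPart_nonneg x)]
      exact sup_le (le_abs_self x) (abs_nonneg x))
    have h2 : x⁻ ∈ Y := hY.solid hx (by
      rw [abs_of_nonneg (negPart_nonneg x)]
      exact sup_le (neg_le_abs x) (abs_nonneg x))
    rw [← posPart_sub_negPart x, map_sub, hfix _ ⟨posPart_nonneg x, h1⟩,
      hfix _ ⟨negPart_nonneg x, h2⟩]

theorem bandPreserving_of_commute (hE : OrderContinuousNorm E) {R : E →L[ℝ] E}
    (h : ∀ P, IsBandProj P → Commute R P) : BandPreserving (R : E →ₗ[ℝ] E) := by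
  intro Y hY x hx
  obtain ⟨P, hP, hmem, hfix⟩ := hY.exists_bandProj hE
  have := DFunLike.congr_fun (h P hP).eq x
  simp only [mul_apply_eq_comp, hfix x hx] at this
  rw [ContinuousLinearMap.coe_coe, this]
  exact hmem _

end Bands

end BanachLattice

theorem theorem5p1 {E : Type*} [NormedAddCommGroup E] [NormedSpace ℝ E] [CompleteSpace E]
    [Lattice E] [IsOrderedAddMonoid E] [IsOrderedModule ℝ E] [HasSolidNorm E]
    (hE : BanachLattice.OrderContinuousNorm E) (ε : ℝ) (hε : 0 ≤ ε) (T : E →L[ℝ] E)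
    (hT : BanachLattice.AlmostBandPreserving ε (T : E →ₗ[ℝ] E)) :
    ∃ R : E →L[ℝ] E, BanachLattice.BandPreserving (R : E →ₗ[ℝ] E) ∧
      ‖R‖ ≤ ‖T‖ ∧ ‖T - R‖ ≤ 4 * ε := by
  obtain ⟨B, hB, hBT, hTB⟩ := BanachLattice.exists_isLocal_limit hε hT
  obtain ⟨R, hR⟩ := hB.exists_operator hE
  refine ⟨R, BanachLattice.bandPreserving_of_commute hE fun P hP => ?_, ?_, ?_⟩
  -- Locality of `B`, tested against functionals, is exactly commutation of `R` with `P`.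
  · refine ContinuousLinearMap.ext fun x => (SeparatingDual.eq_iff_forall_dual_eq (R := ℝ)).2 fun φ => ?_
    change φ (R (P x)) = (φ.comp P) (R x)
    rw [hR, hR, hB hP]
  · refine R.opNorm_le_bound (norm_nonneg _) fun x =>
      NormedSpace.norm_le_dual_bound ℝ _ (by positivity) fun φ => ?_
    rw [hR]
    exact hBT x φ
  · refine (T - R).opNorm_le_bound (by positivity) fun x =>
      NormedSpace.norm_le_dual_bound ℝ _ (by positivity) fun φ => ?_
    rw [sub_apply, map_sub, hR]
    exact hTB x φ
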